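/- Let $M$ be a matroid on the ground set $E=\{e_1,\dots,e_n\}$ that is realizable over $\mathbb{C}$, i.e. there are vectors $f(e_1),\dots,f(e_n)$ in some $\mathbb{C}^d$ such that $I\subseteq E$ is independent in $M$ if and only if the family $(f(e))_{e\in I}$ is linearly independent. Let $P=\{p_1,p_2,\dots\}$ be an infinite set of places. Let $\mathrm{Super}(L^-)$ be the exterior algebra over $\mathbb{Z}$ of the free module with basis $E$, and $\mathrm{Super}(L^-|P^+)$ the exterior algebra over $\mathbb{Z}$ of the free module with basis the letter-place pairs $(e|p)$, $e\in E$, $p\in P$. For an exponent $\alpha=(\alpha_1,\alpha_2,\dots)$ of nonnegative integers, finitely many nonzero, write $p^{(\alpha)}=\prod_j p_j^{(\alpha_j)}$ in the divided power algebra. The Laplace pairing $(w|p^{(\alpha)})\in \mathrm{Super}(L^-|P^+)$, additive in $w\in\mathrm{Super}(L^-)$, is determined by: $(1|1)=1$; $(e|p_j^{(1)})=(e|p_j)$; $(w|p^{(\alpha)})=0$ if $w$ is homogeneous of degree different from $\sum_j\alpha_j$; and $(ww'|p^{(\alpha)})=\sum_{\beta+\gamma=\alpha}(w|p^{(\beta)})(w'|p^{(\gamma)})$.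 The Whitney module $W(M)$ is the quotient of $\mathrm{Super}(L^-|P^+)$ by the two-sided ideal generated by all $(w|p^{(\alpha)})$, where $w=e_{i_1}\cdots e_{i_k}$ is a word whose set of letters is dependent in $M$ and $\sum_j\alpha_j=k$. A tableau of shape $\lambda$ (a partition) is a filling of the boxes of the Young frame of $\lambda$; it is column strict if its rows weakly increase and its columns strictly increase. The content of a tableau $T$ with entries in $\{1,\dots,n\}$ is $\mu=(\mu_1,\dots,\mu_n)$, where $\mu_i$ is the number of $i$'s in $T$. For such a $T$ and a column strict tableau $S$ of the same shape $\lambda$ with $\ell$ rows and entries in $\{1,2,\dots\}$, put $\mathrm{tab}(T|S)=(w_1|q_1)(w_2|q_2)\cdots(w_\ell|q_\ell)$, where $w_i$ is the product, in order, of the elements $e_t$ for the entries $t$ of the $i$-th row of $T$, and $q_i=\prod_j p_j^{(k_{ij})}$ with $k_{ij}$ the number of $j$'s in the $i$-th row of $S$. For a matroid $N$, the rank partition $\rho(N)=(\rho_1,\rho_2,\dots)$ is defined by the condition that, for every $k$, $\rho_1+\dots+\rho_k$ is the size of the largest union of $k$ independent sets of $N$. For $\mu\in\mathbb{Z}_{\ge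 0}^n$, let $M_\mu$ be the parallel extension of $M$ in which $e_i$ is replaced by $\mu_i$ parallel copies of $e_i$ (deleted if $\mu_i=0$; copies of a loop are loops). The dominance relation $\lambda\le\rho$ means $\lambda_1+\dots+\lambda_k\le\rho_1+\dots+\rho_k$ for all $k$, and $\sum_i\lambda_i=\sum_i\rho_i$. **Corollary.** Let $\lambda$ be a partition and $\mu\in\mathbb{Z}_{\ge 0}^n$. There exist a tableau $T$ of shape $\lambda$ with entries in $\{1,\dots,n\}$ and content $\mu$ and a column strict tableau $S$ of shape $\lambda$ such that the image of $\mathrm{tab}(T|S)$ in $W(M)$ is nonzero if and only if $|\lambda|=\mu_1+\dots+\mu_n$ and $\lambda\le\rho(M_\mu)$ in dominance order. -/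

import Mathlib

noncomputable section

namespace WhitneyTableaux

/-! ### Letters, places and the Laplace pairing

The matroid lives on `Fin n`; the letter attached to `e : Fin n` is negatively signed.  The places
`p_0, p_1, p_2, …` are indexed by `ℕ` (only their order matters). -/

/-- `Super(L⁻)`: the exterior algebra over `ℤ` of the free module on the letters. -/
abbrev SuperL (n : ℕ) : Type := ExteriorAlgebra ℤ (Fin n →₀ ℤ)

/-- `Super(L⁻|P⁺)`: the exterior algebra over `ℤ` of the free module on the set of
letter-place pairs `(e|p)`. -/
abbrev SuperLP (n : ℕ) : Type := ExteriorAlgebra ℤ ((Fin n × ℕ) →₀ ℤ)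

/-- The element of `Super(L⁻)` given by a single letter. -/
def letter {n : ℕ} (e : Fin n) : SuperL n :=
  ExteriorAlgebra.ι ℤ (Finsupp.single e 1)

/-- The letter-place pair `(e|p)` as an element of `Super(L⁻|P⁺)`. -/
def letterPlace {n : ℕ} (e : Fin n) (p : ℕ) : SuperLP n :=
  ExteriorAlgebra.ι ℤ (Finsupp.single (e, p) 1)

/-- The product in `Super(L⁻)` of the letters of a word. -/
def wordElt {n : ℕ} (w : List (Fin n)) : SuperL n := (w.map letter).prod

/-- Auxiliary to the Laplace pairing: for a vector `v` of letters, the combination of letter-place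
pairs `(v|p_j)` if `α` is the exponent of the single place `p_j`, and `0` if `α` does not have
total degree one. -/
def degreeOnePart (n : ℕ) (α : ℕ →₀ ℕ) : (Fin n →₀ ℤ) →ₗ[ℤ] ((Fin n × ℕ) →₀ ℤ) :=
  if α.degree = 1 then ∑ j ∈ α.support, Finsupp.lmapDomain ℤ ℤ (fun e => (e, j)) else 0

/-- Auxiliary to the Laplace pairing: the series `∑ⱼ (v|p_j) X_j`. -/
def degreeOneSeries (n : ℕ) : (Fin n →₀ ℤ) →ₗ[ℤ] MvPowerSeries ℕ (SuperLP n) where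
  toFun v := fun α => ExteriorAlgebra.ι ℤ (degreeOnePart n α v)
  map_add' u v := by funext α; exact (by simp only [map_add] :
    ExteriorAlgebra.ι ℤ (degreeOnePart n α (u + v)) =
      ExteriorAlgebra.ι ℤ (degreeOnePart n α u) + ExteriorAlgebra.ι ℤ (degreeOnePart n α v))
  map_smul' c v := by funext α; exact (by simp only [map_smul] :
    ExteriorAlgebra.ι ℤ (degreeOnePart n α (c • v)) =
      c • ExteriorAlgebra.ι ℤ (degreeOnePart n α v))

theorem coeff_degreeOneSeries {n : ℕ} (α : ℕ →₀ ℕ) (v : Fin n →₀ ℤ) :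
    MvPowerSeries.coeff α (degreeOneSeries n v) = ExteriorAlgebra.ι ℤ (degreeOnePart n α v) := rfl

theorem degreeOneSeries_mul_self {n : ℕ} (v : Fin n →₀ ℤ) :
    degreeOneSeries n v * degreeOneSeries n v = 0 := by
  classical
  ext1 α
  rw [MvPowerSeries.coeff_mul, map_zero]
  refine Finset.sum_involution (fun x _ => x.swap) ?_ ?_ ?_ ?_
  · intro x _
    simp only [coeff_degreeOneSeries, Prod.fst_swap, Prod.snd_swap]
    exact ExteriorAlgebra.ι_add_mul_swap _ _
  · rintro ⟨β, γ⟩ _ hne heq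
    obtain rfl : γ = β := congrArg Prod.fst heq
    exact hne (ExteriorAlgebra.ι_sq_zero _)
  · rintro ⟨β, γ⟩ h
    simpa [add_comm] using h
  · intro x _
    exact Prod.swap_swap x

/-- The generating series of the Laplace pairing.  The divided power algebra `Super(P⁺)` is free
over `ℤ` on the monomials `p^(α) = ∏ⱼ p_j^(α_j)`, with `δ(p^(α)) = ∑_{β+γ=α} p^(β) ⊗ p^(γ)`.  Hence
an additive map `q ↦ Ω(w, q)` is the same as the power series `∑_α Ω(w, p^(α)) X^α`, and the
Laplace rule `Ω(ww', q) = ∑ Ω(w, q₁) Ω(w', q₂)` says that `w ↦ ∑_α Ω(w, p^(α)) X^α` is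
multiplicative: it is the algebra homomorphism that extends `e ↦ ∑ⱼ (e|p_j) X_j`. -/
def laplaceSeries (n : ℕ) : SuperL n →ₐ[ℤ] MvPowerSeries ℕ (SuperLP n) :=
  ExteriorAlgebra.lift ℤ ⟨degreeOneSeries n, degreeOneSeries_mul_self⟩

theorem laplaceSeries_ι {n : ℕ} (v : Fin n →₀ ℤ) :
    laplaceSeries n (ExteriorAlgebra.ι ℤ v) = degreeOneSeries n v :=
  ExteriorAlgebra.lift_ι_apply ℤ _ (degreeOneSeries_mul_self (n := n)) v

/-- The Laplace pairing `Ω(w, p^(α)) = (w|p^(α))`. -/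
def laplace {n : ℕ} (w : SuperL n) (α : ℕ →₀ ℕ) : SuperLP n :=
  MvPowerSeries.coeff α (laplaceSeries n w)

/-- `Ω(1, 1) = 1`, and `Ω(1, p^(α)) = 0` in positive degree. -/
theorem laplace_one {n : ℕ} (α : ℕ →₀ ℕ) :
    laplace (1 : SuperL n) α = if α = 0 then 1 else 0 := by
  classical
  rw [laplace, map_one, MvPowerSeries.coeff_one]

/-- `Ω(e, p_j) = (e|p_j)`. -/
theorem laplace_letter_single {n : ℕ} (e : Fin n) (j : ℕ) :
    laplace (letter e) (Finsupp.single j 1) = letterPlace e j := by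
  rw [laplace, letter, laplaceSeries_ι, coeff_degreeOneSeries, degreeOnePart, if_pos (by simp),
    Finsupp.support_single_ne_zero j one_ne_zero]
  simp [letterPlace]

/-- `Ω(e, p^(α)) = 0` if `p^(α)` does not have degree one. -/
theorem laplace_letter_of_degree_ne {n : ℕ} (e : Fin n) (α : ℕ →₀ ℕ) (h : α.degree ≠ 1) :
    laplace (letter e) α = 0 := by
  rw [laplace, letter, laplaceSeries_ι, coeff_degreeOneSeries, degreeOnePart, if_neg h]
  simp

/-- `Ω(ww', p^(α)) = ∑_{β+γ=α} Ω(w, p^(β)) Ω(w', p^(γ))`. -/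
theorem laplace_mul {n : ℕ} (w w' : SuperL n) (α : ℕ →₀ ℕ) :
    laplace (w * w') α = ∑ x ∈ Finset.HasAntidiagonal.antidiagonal α, laplace w x.1 * laplace w' x.2 := by
  classical
  simp only [laplace, map_mul]
  rw [MvPowerSeries.coeff_mul]

/-- The pairing vanishes if the degrees of the two arguments differ. -/
theorem laplace_wordElt_of_degree_ne {n : ℕ} (w : List (Fin n)) (α : ℕ →₀ ℕ)
    (h : α.degree ≠ w.length) : laplace (wordElt w) α = 0 := by
  induction w generalizing α with
  | nil =>
    have h0 : α ≠ 0 := by rintro rfl; simp at h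
    rw [wordElt, List.map_nil, List.prod_nil, laplace_one, if_neg h0]
  | cons e w ih =>
    rw [wordElt, List.map_cons, List.prod_cons, laplace_mul]
    refine Finset.sum_eq_zero fun x hx => ?_
    by_cases h1 : x.1.degree = 1
    · have h2 : x.2.degree ≠ w.length := by
        intro h2
        apply h
        rw [← Finset.HasAntidiagonal.mem_antidiagonal.mp hx, map_add, h1, h2, List.length_cons, add_comm]
      have h3 := ih x.2 h2
      rw [wordElt] at h3
      rw [h3, mul_zero]
    · rw [laplace_letter_of_degree_ne e x.1 h1, zero_mul]

/-! ### The Whitney module -/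

/-- The two-sided ideal of `Super(L⁻|P⁺)` generated by the elements `(w|p^(α))`, where `w` is a
dependent word of `M` and `α` is a (weak) composition of `|w|`. -/
def whitneyIdeal {n : ℕ} (M : Matroid (Fin n)) : TwoSidedIdeal (SuperLP n) :=
  TwoSidedIdeal.span {x | ∃ (w : List (Fin n)) (α : ℕ →₀ ℕ),
    M.Dep {e | e ∈ w} ∧ α.degree = w.length ∧ x = laplace (wordElt w) α}

/-- The Whitney module `W(M)`. -/
abbrev WhitneyModule {n : ℕ} (M : Matroid (Fin n)) : Type := (whitneyIdeal M).ringCon.Quotient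

/-- The projection `Super(L⁻|P⁺) → W(M)`. -/
def WhitneyModule.mk {n : ℕ} (M : Matroid (Fin n)) : SuperLP n →+* WhitneyModule M :=
  (whitneyIdeal M).ringCon.mk'

/-! ### Tableaux

A partition is a Young diagram `lam`, whose `i`-th part is `lam.rowLen i`. Column strict
tableaux (rows weakly increasing, columns strictly increasing) with entries in the places are
Mathlib's semistandard Young tableaux. -/

/-- A tableau of shape `lam` with entries in `Fin n`: an arbitrary filling of the boxes. -/
abbrev Tableau (lam : YoungDiagram) (n : ℕ) : Type := {c : ℕ × ℕ // c ∈ lam} → Fin n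

/-- The content of `T`: how often each element occurs. -/
def content {lam : YoungDiagram} {n : ℕ} (T : Tableau lam n) (e : Fin n) : ℕ :=
  Nat.card {c // T c = e}

/-- The word read off the `i`-th row of `T`, from left to right. -/
def rowWord {lam : YoungDiagram} {n : ℕ} (T : Tableau lam n) (i : ℕ) : List (Fin n) :=
  List.ofFn fun j : Fin (lam.rowLen i) => T ⟨(i, j), YoungDiagram.mem_iff_lt_rowLen.mpr j.2⟩

/-- The exponent `α` of the monomial `p^(α)` given by the `i`-th row of the column strict tableau
`S`.  The row weakly increases, so all the occurrences of a place in it form one string of equal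
entries: the divided power `p_j^(k)` appears with `k` the number of `j`s in the row. -/
def rowExponent {lam : YoungDiagram} (S : SemistandardYoungTableau lam) (i : ℕ) : ℕ →₀ ℕ :=
  ∑ j ∈ Finset.range (lam.rowLen i), Finsupp.single (S i j) 1

/-- `tab(T|S) = (w_1|q_1)(w_2|q_2)⋯(w_ℓ|q_ℓ)` in `Super(L⁻|P⁺)`, the product over the rows, from
top to bottom; `lam.colLen 0` is the number of rows. -/
def tab {lam : YoungDiagram} {n : ℕ} (T : Tableau lam n) (S : SemistandardYoungTableau lam) :
    SuperLP n :=
  ((List.range (lam.colLen 0)).map fun i =>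
    laplace (wordElt (rowWord T i)) (rowExponent S i)).prod

/-! ### Matroids -/

/-- `M` is realizable over `ℂ`: some vectors indexed by the ground set have the independent sets
of `M` as their linearly independent subfamilies. -/
def IsRealizable {n : ℕ} (M : Matroid (Fin n)) : Prop :=
  ∃ (d : ℕ) (f : Fin n → (Fin d → ℂ)), ∀ I : Set (Fin n), M.Indep I ↔ LinearIndepOn ℂ f I

/-- The parallel extension `M_μ`: the element `e` is replaced by `μ e` parallel copies of itself
(none if `μ e = 0`).  A set of copies is independent if it contains at most one copy of each
element and the elements involved are independent in `M`. -/
def parallelExtension {n : ℕ} (M : Matroid (Fin n)) (μ : Fin n → ℕ) :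
    Matroid (Σ e : Fin n, Fin (μ e)) :=
  M.comap Sigma.fst

/-- The size of the largest union of `k` independent sets of `M`. -/
def maxUnion {E : Type*} (M : Matroid E) (k : ℕ) : ℕ :=
  sSup {m | ∃ I : Fin k → Set E, (∀ i, M.Indep (I i)) ∧ (⋃ i, I i).ncard = m}

/-- The rank partition of `M`; `rankPartition M i` is the `(i+1)`-st part.  The difference is
nonnegative and the sum of the first `k` parts is `maxUnion M k`, see `sum_rankPartition`. -/
def rankPartition {E : Type*} (M : Matroid E) (i : ℕ) : ℕ :=
  maxUnion M (i + 1) - maxUnion M i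

theorem bddAbove_maxUnion {E : Type*} [Finite E] (M : Matroid E) (k : ℕ) :
    BddAbove {m | ∃ I : Fin k → Set E, (∀ i, M.Indep (I i)) ∧ (⋃ i, I i).ncard = m} := by
  refine ⟨Nat.card E, ?_⟩
  rintro m ⟨I, _, rfl⟩
  exact Set.ncard_le_card _

theorem maxUnion_mono {E : Type*} [Finite E] (M : Matroid E) (k : ℕ) :
    maxUnion M k ≤ maxUnion M (k + 1) := by
  refine csSup_le_csSup (bddAbove_maxUnion M (k + 1))
    ⟨_, fun _ => ∅, fun _ => M.empty_indep, rfl⟩ ?_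
  rintro m ⟨I, hI, rfl⟩
  refine ⟨Fin.cons ∅ I, fun i => ?_, ?_⟩
  · refine Fin.cases ?_ (fun i => ?_) i
    · exact M.empty_indep
    · exact hI i
  · congr 1
    ext x
    simp

theorem sum_rankPartition {E : Type*} [Finite E] (M : Matroid E) (k : ℕ) :
    ∑ i ∈ Finset.range k, rankPartition M i = maxUnion M k := by
  induction k with
  | zero => simp [maxUnion]
  | succ k ih =>
    rw [Finset.sum_range_succ, ih, rankPartition]
    have := maxUnion_mono M k
    omega

/-- The dominance order `a ≤ b` on sequences with finitely many nonzero terms and equal total. -/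
def Dominated (a b : ℕ → ℕ) : Prop :=
  (∀ k, ∑ i ∈ Finset.range k, a i ≤ ∑ i ∈ Finset.range k, b i) ∧
    ∃ N, ∀ k ≥ N, ∑ i ∈ Finset.range k, a i = ∑ i ∈ Finset.range k, b i

end WhitneyTableaux

end

/-! If `tab(T|S)` survives in `W(M)`, every row factor survives. A row with a repeated letter is
zero already in the exterior algebra, and a row on a dependent set gives a generator of the ideal.
So the rows of `T` are repetition-free independent words. Matching the boxes of `T` with the
elements of `M_μ` turns the first `k` rows into `k` independent sets with disjoint union of size `λ₁
+ ⋯ + λ_k`, which is the dominance inequality.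

Conversely, dominance yields a partition of the ground set of `M_μ` into independent sets of sizes
`λ₁, λ₂, …` (`exists_indep_partition_rowLen`). This is Edmonds' theorem, obtained here from Rado's
minimality argument for submodular functions. The parts become the rows of `T`. Take `S` with `i`-th
row constantly `i`: each row factor is then a single product of pairs `(e|p_i)`, with no sum and no
coefficient.

Nonvanishing is detected by a realization `f`. The map `(e|p) ↦ f(e) ⊗ p` into the exterior algebra
of `V ⊗ ℂ^P` kills the ideal, because the image of `(w|p^(α))` depends only on the product of the
`f(e)` in the exterior algebra of `V`, and this is zero for dependent `w`. The image of `tab(T|S)`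
is a product of linearly independent vectors: each row is independent, and different rows use
different places. -/

noncomputable section

namespace WhitneyTableaux

/-! ### Partition into independent sets -/

/-- Rado's reduction: if a monotone submodular set function `h` satisfies the Hall-type condition
on a product, then it satisfies it on the graph of a function. -/
theorem exists_function_of_hall {α κ : Type*} [Fintype α] [Fintype κ] [DecidableEq α]
    [DecidableEq κ] (h : Finset (α × κ) → ℕ) (h0 : h ∅ = 0) (mono : Monotone h)
    (submod : ∀ P Q, h (P ∪ Q) + h (P ∩ Q) ≤ h P + h Q)
    (hall : ∀ X : Finset α, X.card ≤ h (Finset.univ.filter (·.1 ∈ X))) :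
    ∃ φ : α → κ, ∀ X : Finset α, X.card ≤ h (X.image fun e => (e, φ e)) := by
  -- Among the sets of pairs satisfying the Hall condition, an inclusion-minimal one is shown to be
  -- the graph of a function.
  obtain ⟨Y, hY⟩ := exists_minimal_of_wellFoundedLT
    (fun Y : Finset (α × κ) => ∀ X : Finset α, X.card ≤ h (Y.filter (·.1 ∈ X))) ⟨_, hall⟩
  have hex : ∀ e, ∃ i, (e, i) ∈ Y := by
    intro e
    by_contra! hne
    have h1 := hY.prop {e}
    have h2 : Y.filter (·.1 ∈ ({e} : Finset α)) = ∅ := by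
      ext ⟨a, i⟩
      simp only [Finset.mem_filter, Finset.mem_singleton, Finset.notMem_empty, iff_false, not_and]
      rintro ha rfl
      exact hne i ha
    rw [h2, h0] at h1
    simp at h1
  -- By minimality, deleting `p` violates the condition at some `X`, which must contain `p.1` since
  -- otherwise nothing over `X` changes.
  have herase : ∀ p ∈ Y, ∃ X : Finset α, p.1 ∈ X ∧ h ((Y.filter (·.1 ∈ X)).erase p) < X.card := by
    intro p hp
    by_contra! hne
    have hle : ∀ X : Finset α, X.card ≤ h ((Y.erase p).filter (·.1 ∈ X)) := by
      intro X
      rw [Finset.filter_erase]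
      by_cases hpX : p.1 ∈ X
      · exact hne X hpX
      · rw [Finset.erase_eq_of_notMem (by simp [hpX])]
        exact hY.prop X
    exact Finset.notMem_erase p Y (hY.le_of_le hle (Finset.erase_subset p Y) hp)
  -- Two pairs over `e` would give violating sets `X₁` and `X₂`. The union of the two reduced sets
  -- still covers everything over `X₁ ∪ X₂`, as `i ≠ j`, and their intersection covers everything
  -- over `X₁ ∩ X₂` except at `e`. Submodularity then bounds `|X₁| + |X₂| - 1` by a sum that is at
  -- most `|X₁| + |X₂| - 2`.
  have huniq : ∀ e i j, (e, i) ∈ Y → (e, j) ∈ Y → i = j := by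
    intro e i j hi hj
    by_contra hij
    obtain ⟨X₁, he₁, h₁⟩ := herase _ hi
    obtain ⟨X₂, he₂, h₂⟩ := herase _ hj
    have hs := submod ((Y.filter (·.1 ∈ X₁)).erase (e, i)) ((Y.filter (·.1 ∈ X₂)).erase (e, j))
    have hun : Y.filter (·.1 ∈ X₁ ∪ X₂) ⊆
        (Y.filter (·.1 ∈ X₁)).erase (e, i) ∪ (Y.filter (·.1 ∈ X₂)).erase (e, j) := by
      rintro ⟨a, k⟩ hak
      simp only [Finset.mem_filter, Finset.mem_union, Finset.mem_erase, Prod.mk.injEq, ne_eq,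
        not_and] at hak ⊢
      grind
    have hin : Y.filter (·.1 ∈ (X₁ ∩ X₂).erase e) ⊆
        (Y.filter (·.1 ∈ X₁)).erase (e, i) ∩ (Y.filter (·.1 ∈ X₂)).erase (e, j) := by
      rintro ⟨a, k⟩ hak
      simp only [Finset.mem_filter, Finset.mem_inter, Finset.mem_erase, Prod.mk.injEq, ne_eq,
        not_and] at hak ⊢
      grind
    have h3 := (hY.prop (X₁ ∪ X₂)).trans (mono hun)
    have h4 := (hY.prop ((X₁ ∩ X₂).erase e)).trans (mono hin)
    rw [Finset.card_erase_of_mem (Finset.mem_inter.mpr ⟨he₁, he₂⟩)] at h4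
    have h5 := Finset.card_union_add_card_inter X₁ X₂
    omega
  choose φ hφ using hex
  refine ⟨φ, fun X => (hY.prop X).trans (mono ?_)⟩
  rintro ⟨a, k⟩ hak
  rw [Finset.mem_filter] at hak
  exact Finset.mem_image.mpr ⟨a, hak.2, by rw [huniq a _ _ hak.1 (hφ a)]⟩

/-- The natural-valued rank of a finite set in a matroid. -/
def finRank {α : Type*} (N : Matroid α) (X : Finset α) : ℕ := (N.eRk X).toNat

theorem coe_finRank {α : Type*} (N : Matroid α) (X : Finset α) :
    (finRank N X : ℕ∞) = N.eRk X :=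
  ENat.natCast_toNat <| ((N.eRk_le_encard X).trans_lt (by simp)).ne

theorem finRank_mono {α : Type*} (N : Matroid α) : Monotone (finRank N) := by
  intro X Y hXY
  have := N.eRk_mono (Finset.coe_subset.mpr hXY)
  rw [← coe_finRank, ← coe_finRank] at this
  exact_mod_cast this

theorem finRank_submod {α : Type*} [DecidableEq α] (N : Matroid α) (X Y : Finset α) :
    finRank N (X ∪ Y) + finRank N (X ∩ Y) ≤ finRank N X + finRank N Y := by
  have := N.eRk_inter_add_eRk_union_le X Y
  rw [← Finset.coe_inter, ← Finset.coe_union] at this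
  simp only [← coe_finRank] at this
  have h : finRank N (X ∩ Y) + finRank N (X ∪ Y) ≤ finRank N X + finRank N Y := by
    exact_mod_cast this
  omega

theorem indep_of_card_le_finRank {α : Type*} (N : Matroid α) (X : Finset α)
    (h : X.card ≤ finRank N X) : N.Indep X := by
  have h1 : (X.card : ℕ∞) ≤ N.eRk X := by rw [← coe_finRank]; exact_mod_cast h
  obtain ⟨I, hIX, hI, hc⟩ := Matroid.le_eRk_iff.mp h1
  have : I = X := ((Finset.finite_toSet X).subset hIX).eq_of_subset_of_encard_le hIX (by simp [hc])
  exact this ▸ hI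

theorem card_le_finRank_of_indep {α : Type*} (N : Matroid α) {X Y : Finset α}
    (hX : N.Indep X) (h : X ⊆ Y) : X.card ≤ finRank N Y := by
  have h1 := hX.encard_le_eRk_of_subset (Finset.coe_subset.mpr h)
  rw [← coe_finRank, Set.encard_coe_eq_coe_finsetCard] at h1
  exact_mod_cast h1

/-- Edmonds' partition theorem for truncations of a single matroid. -/
theorem exists_indep_partition {α κ : Type*} [Fintype α] [Fintype κ] [DecidableEq α]
    [DecidableEq κ] (N : Matroid α) (a : κ → ℕ)
    (hall : ∀ X : Finset α, X.card ≤ ∑ i, min (a i) (finRank N X)) :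
    ∃ φ : α → κ, ∀ i, N.Indep {e | φ e = i} ∧ (Finset.univ.filter (φ · = i)).card ≤ a i := by
  have hmono : ∀ (i : κ) {P Q : Finset (α × κ)}, P ⊆ Q →
      (Finset.univ.filter fun e => (e, i) ∈ P) ⊆ Finset.univ.filter fun e => (e, i) ∈ Q := by
    intro i P Q hPQ e
    simpa using fun h => hPQ h
  have hempty : finRank N ∅ = 0 := by simp [finRank]
  obtain ⟨φ, hφ⟩ := exists_function_of_hall
    (fun Y => ∑ i, min (a i) (finRank N (Finset.univ.filter fun e => (e, i) ∈ Y)))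
    (by simp [hempty])
    (fun P Q hPQ => Finset.sum_le_sum fun i _ =>
      min_le_min le_rfl (finRank_mono N (hmono i hPQ)))
    -- Truncating a monotone submodular function at a constant keeps it submodular; this is checked
    -- slice by slice.
    (fun P Q => by
      simp only [← Finset.sum_add_distrib]
      refine Finset.sum_le_sum fun i _ => ?_
      have h1 := finRank_submod N (Finset.univ.filter fun e => (e, i) ∈ P)
        (Finset.univ.filter fun e => (e, i) ∈ Q)
      rw [← Finset.filter_or, ← Finset.filter_and] at h1
      simp only [← Finset.mem_union, ← Finset.mem_inter] at h1
      have h2 := finRank_mono N (hmono i (Finset.inter_subset_left (s₁ := P) (s₂ := Q)))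
      have h3 := finRank_mono N (hmono i (Finset.inter_subset_right (s₁ := P) (s₂ := Q)))
      have h4 := finRank_mono N (hmono i (Finset.subset_union_left (s₁ := P) (s₂ := Q)))
      have h5 := finRank_mono N (hmono i (Finset.subset_union_right (s₁ := P) (s₂ := Q)))
      omega)
    (fun X => by simpa using hall X)
  refine ⟨φ, fun i => ?_⟩
  -- Over the class of `i` the graph has only one nonempty slice, the class itself, so the Hall
  -- bound reduces to the single term `min (a i) (rank)`.
  have h1 := hφ (Finset.univ.filter (φ · = i))
  rw [Finset.sum_eq_single i] at h1
  · have h2 : (Finset.univ.filter fun e => (e, i) ∈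
        (Finset.univ.filter (φ · = i)).image fun e => (e, φ e)) = Finset.univ.filter (φ · = i) := by
      ext e; simp
    rw [h2, le_min_iff] at h1
    exact ⟨by simpa using indep_of_card_le_finRank N _ h1.2, h1.1⟩
  · intro j _ hji
    have h2 : (Finset.univ.filter fun e => (e, j) ∈
        (Finset.univ.filter (φ · = i)).image fun e => (e, φ e)) = ∅ := by
      ext e
      simp only [Finset.mem_filter, Finset.mem_univ, true_and, Finset.mem_image, Prod.mk.injEq,
        Finset.notMem_empty, iff_false]
      rintro ⟨e, rfl, rfl, rfl⟩
      exact hji rfl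
    rw [h2, hempty, Nat.min_zero]
  · simp

/-- The easy half of the matroid union formula. -/
theorem maxUnion_le {α : Type*} [Fintype α] [DecidableEq α] (N : Matroid α) (k : ℕ)
    (X : Finset α) : maxUnion N k ≤ k * finRank N X + Xᶜ.card := by
  classical
  refine csSup_le ⟨_, fun _ => ∅, fun _ => N.empty_indep, rfl⟩ ?_
  rintro m ⟨I, hI, rfl⟩
  -- Each of the `k` independent sets has at most `finRank N X` elements inside `X`; what lies
  -- outside is counted once by the complement.
  have h1 : (⋃ i, I i) ⊆ ((Finset.univ.biUnion fun i => (I i).toFinset ∩ X) ∪ Xᶜ : Finset α) := by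
    intro x hx
    obtain ⟨i, hi⟩ := Set.mem_iUnion.mp hx
    by_cases hxX : x ∈ X
    · simpa [hxX] using ⟨i, hi⟩
    · simp [hxX]
  refine (Set.ncard_le_ncard h1).trans ?_
  rw [Set.ncard_coe_finset]
  refine (Finset.card_union_le _ _).trans (Nat.add_le_add_right ?_ _)
  refine Finset.card_biUnion_le.trans ?_
  refine (Finset.sum_le_card_nsmul _ _ (finRank N X) fun i _ => ?_).trans (by simp)
  exact card_le_finRank_of_indep N ((hI i).subset (by intro x; simp; tauto))
    Finset.inter_subset_right

theorem card_eq_sum_rowLen (lam : YoungDiagram) :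
    lam.card = ∑ i ∈ Finset.range (lam.colLen 0), lam.rowLen i := by
  have h : Set.MapsTo Prod.fst (lam.cells : Set (ℕ × ℕ)) (Finset.range (lam.colLen 0)) := by
    rintro ⟨i, j⟩ hc
    rw [Finset.coe_range, Set.mem_Iio, ← YoungDiagram.mem_iff_lt_colLen]
    exact lam.up_left_mem le_rfl (Nat.zero_le j) hc
  rw [YoungDiagram.card, Finset.card_eq_sum_card_fiberwise h]
  exact Finset.sum_congr rfl fun i _ => by rw [YoungDiagram.rowLen_eq_card]; rfl

theorem rowLen_eq_zero {lam : YoungDiagram} {i : ℕ} (h : lam.colLen 0 ≤ i) : lam.rowLen i = 0 := by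
  by_contra h0
  have h1 := YoungDiagram.mem_iff_lt_rowLen.mpr (Nat.pos_of_ne_zero h0)
  rw [YoungDiagram.mem_iff_lt_colLen] at h1
  omega

/-- A shape bounded by the sizes of unions of independent sets is the sequence of sizes of a
partition of the ground set into independent sets. -/
theorem exists_indep_partition_rowLen {α : Type*} [Fintype α] [DecidableEq α] (N : Matroid α)
    (lam : YoungDiagram) (hcard : lam.card = Fintype.card α)
    (hle : ∀ k, ∑ i ∈ Finset.range k, lam.rowLen i ≤ maxUnion N k) :
    ∃ φ : α → Fin (lam.colLen 0), ∀ i, N.Indep {e | φ e = i} ∧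
      (Finset.univ.filter (φ · = i)).card = lam.rowLen i := by
  obtain ⟨φ, hφ⟩ := exists_indep_partition N (fun i : Fin (lam.colLen 0) => lam.rowLen i) <| by
    intro X
    set r := finRank N X with hr
    rw [Finset.sum_range (fun i => min (lam.rowLen i) r) |>.symm]
    -- `lam.colLen r` is the number `k` of rows longer than `r`, so the sum of the minima is `k * r`
    -- plus the lengths of the remaining rows. The bound on the first `k` rows by `k * r + |Xᶜ|`
    -- turns this into at least `|X|`.
    have hk : lam.colLen r ≤ lam.colLen 0 := lam.colLen_anti _ _ (Nat.zero_le r)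
    have hs := Finset.sum_range_add_sum_Ico (fun i => lam.rowLen i) hk
    rw [← card_eq_sum_rowLen] at hs
    rw [← Finset.sum_range_add_sum_Ico _ hk]
    have h1 : ∑ i ∈ Finset.range (lam.colLen r), min (lam.rowLen i) r = lam.colLen r * r := by
      rw [Finset.sum_congr rfl (g := fun _ => r), Finset.sum_const, Finset.card_range, smul_eq_mul]
      intro i hi
      refine min_eq_right ?_
      rw [Finset.mem_range, ← YoungDiagram.mem_iff_lt_colLen, YoungDiagram.mem_iff_lt_rowLen] at hi
      exact hi.le
    have h2 : ∑ i ∈ Finset.Ico (lam.colLen r) (lam.colLen 0), min (lam.rowLen i) r =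
        ∑ i ∈ Finset.Ico (lam.colLen r) (lam.colLen 0), lam.rowLen i := by
      refine Finset.sum_congr rfl fun i hi => min_eq_left ?_
      have hi' := (Finset.mem_Ico.mp hi).1
      rwa [← not_lt, ← YoungDiagram.mem_iff_lt_colLen, YoungDiagram.mem_iff_lt_rowLen,
        not_lt] at hi'
    have h3 := (hle (lam.colLen r)).trans (maxUnion_le N _ X)
    have h4 := X.card_add_card_compl
    rw [← hr] at h3
    rw [h1, h2]
    omega
  refine ⟨φ, fun i => ⟨(hφ i).1, ?_⟩⟩
  -- The classes have at most the prescribed sizes and the totals agree, so all the sizes are exact.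
  have hsum : ∑ i, (Finset.univ.filter (φ · = i)).card = ∑ i : Fin (lam.colLen 0), lam.rowLen i := by
    rw [← Finset.card_eq_sum_card_fiberwise (fun _ _ => Finset.mem_coe.mpr (Finset.mem_univ _)),
      Finset.card_univ, ← hcard, card_eq_sum_rowLen, Finset.sum_range]
  exact (Finset.sum_eq_sum_iff_of_le fun i _ => (hφ i).2).mp hsum i (Finset.mem_univ i)

/-! ### Products of vectors in an exterior algebra over a field -/

theorem prod_map_ι_eq_zero {K V : Type*} [Field K] [AddCommGroup V] [Module K V] (l : List V)
    (h : ¬ LinearIndependent K l.get) : (l.map (ExteriorAlgebra.ι K)).prod = 0 := by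
  have h1 := (ExteriorAlgebra.ιMulti K l.length (M := V)).map_linearDependent l.get h
  rw [ExteriorAlgebra.ιMulti_apply] at h1
  rw [← h1]
  congr 1
  conv_lhs => rw [← List.ofFn_get l, List.map_ofFn]
  rfl

/-- Exterior products of the `k`-element subfamilies of an independent family are linearly
independent in the `k`-th exterior power. With `k` the full length, the only subfamily is the whole
list. -/
theorem prod_map_ι_ne_zero {K V : Type*} [Field K] [AddCommGroup V] [Module K V] (l : List V)
    (h : LinearIndependent K l.get) : (l.map (ExteriorAlgebra.ι K)).prod ≠ 0 := by
  have h1 := (exteriorPower.ιMulti_family_linearIndependent_field (n := l.length) h).ne_zero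
    (Set.powersetCard.ofFinEmbEquiv (RelEmbedding.refl _))
  rw [exteriorPower.ιMulti_family, Equiv.symm_apply_apply] at h1
  intro h0
  apply h1
  apply Subtype.ext
  rw [exteriorPower.ιMulti_apply_coe, ExteriorAlgebra.ιMulti_apply, ZeroMemClass.coe_zero, ← h0]
  congr 1
  conv_rhs => rw [← List.ofFn_get l, List.map_ofFn]
  rfl

/-! ### The map of the Whitney module given by a realization -/

/-- The space `V ⊗ K^P`. -/
abbrev PlaceSpace (d : ℕ) : Type := ℕ →₀ (Fin d → ℂ)

/-- The degree one part of the Laplace pairing over `ℂ`. -/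
def complexDegreeOnePart (d : ℕ) (α : ℕ →₀ ℕ) : (Fin d → ℂ) →ₗ[ℂ] PlaceSpace d :=
  if α.degree = 1 then ∑ j ∈ α.support, Finsupp.lsingle j else 0

/-- The series `∑ⱼ (v|p_j) X_j` over `ℂ`. -/
def complexDegreeOneSeries (d : ℕ) :
    (Fin d → ℂ) →ₗ[ℂ] MvPowerSeries ℕ (ExteriorAlgebra ℂ (PlaceSpace d)) where
  toFun v := fun α => ExteriorAlgebra.ι ℂ (complexDegreeOnePart d α v)
  map_add' u v := by
    funext α
    exact (congrArg _ (map_add (complexDegreeOnePart d α) u v)).trans (map_add _ _ _)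
  map_smul' c v := by
    funext α
    exact (congrArg _ (map_smul (complexDegreeOnePart d α) c v)).trans (map_smul _ _ _)

theorem coeff_complexDegreeOneSeries {d : ℕ} (α : ℕ →₀ ℕ) (v : Fin d → ℂ) :
    MvPowerSeries.coeff α (complexDegreeOneSeries d v) =
      ExteriorAlgebra.ι ℂ (complexDegreeOnePart d α v) := rfl

/-- In each coefficient the terms for `(β, γ)` and `(γ, β)` cancel by anticommutation, and a term
with `β = γ` is a square of a vector. -/
theorem complexDegreeOneSeries_mul_self {d : ℕ} (v : Fin d → ℂ) :
    complexDegreeOneSeries d v * complexDegreeOneSeries d v = 0 := by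
  classical
  ext1 α
  rw [MvPowerSeries.coeff_mul, map_zero]
  refine Finset.sum_involution (fun x _ => x.swap) ?_ ?_ ?_ ?_
  · intro x _
    simp only [coeff_complexDegreeOneSeries, Prod.fst_swap, Prod.snd_swap]
    exact ExteriorAlgebra.ι_add_mul_swap _ _
  · rintro ⟨β, γ⟩ _ hne heq
    obtain rfl : γ = β := congrArg Prod.fst heq
    exact hne (ExteriorAlgebra.ι_sq_zero _)
  · rintro ⟨β, γ⟩ h
    simpa [add_comm] using h
  · intro x _
    exact Prod.swap_swap x

/-- The generating series of the Laplace pairing over `ℂ`. -/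
def complexLaplaceSeries (d : ℕ) : ExteriorAlgebra ℂ (Fin d → ℂ) →ₐ[ℂ]
    MvPowerSeries ℕ (ExteriorAlgebra ℂ (PlaceSpace d)) :=
  ExteriorAlgebra.lift ℂ ⟨complexDegreeOneSeries d, complexDegreeOneSeries_mul_self⟩

/-- The linear map `(e|p) ↦ f(e) ⊗ p`. -/
def realizeLinear {n d : ℕ} (f : Fin n → Fin d → ℂ) : ((Fin n × ℕ) →₀ ℤ) →ₗ[ℤ] PlaceSpace d :=
  Finsupp.linearCombination ℤ fun x => Finsupp.single x.2 (f x.1)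

/-- The ring homomorphism from `Super(L⁻|P⁺)` induced by `(e|p) ↦ f(e) ⊗ p`. -/
def realize {n d : ℕ} (f : Fin n → Fin d → ℂ) :
    SuperLP n →ₐ[ℤ] ExteriorAlgebra ℂ (PlaceSpace d) :=
  ExteriorAlgebra.lift ℤ
    ⟨((ExteriorAlgebra.ι ℂ).toAddMonoidHom.comp (realizeLinear f).toAddMonoidHom).toIntLinearMap,
      fun m => ExteriorAlgebra.ι_sq_zero (R := ℂ) (realizeLinear f m)⟩

theorem realize_ι {n d : ℕ} (f : Fin n → Fin d → ℂ) (v : (Fin n × ℕ) →₀ ℤ) :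
    realize f (ExteriorAlgebra.ι ℤ v) = ExteriorAlgebra.ι ℂ (realizeLinear f v) :=
  ExteriorAlgebra.lift_ι_apply ℤ _ _ v

theorem realize_letterPlace {n d : ℕ} (f : Fin n → Fin d → ℂ) (e : Fin n) (p : ℕ) :
    realize f (letterPlace e p) = ExteriorAlgebra.ι ℂ (Finsupp.single p (f e)) := by
  rw [letterPlace, realize_ι, realizeLinear, Finsupp.linearCombination_single, one_smul]

theorem map_realize_laplaceSeries_letter {n d : ℕ} (f : Fin n → Fin d → ℂ) (e : Fin n) :
    MvPowerSeries.map (σ := ℕ) (realize f).toRingHom (laplaceSeries n (letter e)) =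
      complexLaplaceSeries d (ExteriorAlgebra.ι ℂ (f e)) := by
  ext1 α
  rw [MvPowerSeries.coeff_map, letter, laplaceSeries_ι, coeff_degreeOneSeries,
    complexLaplaceSeries, ExteriorAlgebra.lift_ι_apply, coeff_complexDegreeOneSeries]
  refine (realize_ι f _).trans (congrArg _ ?_)
  rw [degreeOnePart, complexDegreeOnePart]
  split_ifs
  · simp [realizeLinear]
  · simp

/-- Both sides are multiplicative in the word, so agreement on letters suffices. The right side sees
`w` only through the product of its vectors in the exterior algebra of `ℂ^d`. -/
theorem realize_laplace_wordElt {n d : ℕ} (f : Fin n → Fin d → ℂ) (w : List (Fin n))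
    (α : ℕ →₀ ℕ) : realize f (laplace (wordElt w) α) = MvPowerSeries.coeff α
      (complexLaplaceSeries d ((w.map f).map (ExteriorAlgebra.ι ℂ)).prod) := by
  have h : MvPowerSeries.map (σ := ℕ) (realize f).toRingHom (laplaceSeries n (wordElt w)) =
      complexLaplaceSeries d ((w.map f).map (ExteriorAlgebra.ι ℂ)).prod := by
    rw [wordElt, map_list_prod, map_list_prod, map_list_prod]
    congr 1
    simp only [List.map_map]
    exact List.map_congr_left fun e _ => map_realize_laplaceSeries_letter f e
  rw [← h, MvPowerSeries.coeff_map]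
  rfl

theorem not_linearIndependent_get_of_dep {n d : ℕ} {M : Matroid (Fin n)} {f : Fin n → Fin d → ℂ}
    (hf : ∀ I : Set (Fin n), M.Indep I ↔ LinearIndepOn ℂ f I) (w : List (Fin n))
    (hw : M.Dep {e | e ∈ w}) : ¬ LinearIndependent ℂ (w.map f).get := by
  intro h
  apply hw.not_indep
  rw [hf]
  have hr := h.linearIndepOn_id
  -- Independence of the list of values forces `f` to be injective on the letters, so the set of
  -- letters can be compared with its image.
  have hinj : Set.InjOn f {e | e ∈ w} := by
    intro a ha b hb hab
    exact List.inj_on_of_nodup_map (List.nodup_iff_injective_get.mpr h.injective) ha hb hab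
  refine (linearIndepOn_iff_image hinj).mpr ?_
  rw [Set.range_list_get] at hr
  convert hr using 1
  ext x
  simp

theorem whitneyIdeal_le_ker_realize {n d : ℕ} {M : Matroid (Fin n)} {f : Fin n → Fin d → ℂ}
    (hf : ∀ I : Set (Fin n), M.Indep I ↔ LinearIndepOn ℂ f I) :
    whitneyIdeal M ≤ TwoSidedIdeal.ker (realize f) := by
  rw [whitneyIdeal, TwoSidedIdeal.span_le]
  rintro x ⟨w, α, hw, -, rfl⟩
  rw [SetLike.mem_coe, TwoSidedIdeal.mem_ker, realize_laplace_wordElt,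
    prod_map_ι_eq_zero _ (not_linearIndependent_get_of_dep hf w hw), map_zero, map_zero]

theorem mk_eq_zero_iff {n : ℕ} (M : Matroid (Fin n)) (x : SuperLP n) :
    WhitneyModule.mk M x = 0 ↔ x ∈ whitneyIdeal M := by
  rw [WhitneyModule.mk, ← TwoSidedIdeal.mem_ker, TwoSidedIdeal.ker_ringCon_mk']

/-! ### The Laplace pairing with a divided power of a single place -/

/-- The only splitting of `p_i^(k+1)` whose first factor has degree one is `p_i` times `p_i^(k)`;
with divided powers it carries coefficient one. -/
theorem laplace_wordElt_single {n : ℕ} (w : List (Fin n)) (i : ℕ) :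
    laplace (wordElt w) (Finsupp.single i w.length) = (w.map (letterPlace · i)).prod := by
  classical
  induction w with
  | nil => simp [wordElt, laplace_one]
  | cons e w ih =>
    rw [wordElt, List.map_cons, List.prod_cons, laplace_mul,
      Finset.sum_eq_single (Finsupp.single i 1, Finsupp.single i w.length)]
    · rw [laplace_letter_single, ← wordElt, ih, List.map_cons, List.prod_cons]
    · rintro ⟨β, γ⟩ hx hne
      by_cases hβ : β.degree = 1
      · exfalso
        have hadd := Finset.HasAntidiagonal.mem_antidiagonal.mp hx
        have hβ0 : ∀ j, j ≠ i → β j = 0 := by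
          intro j hj
          have := DFunLike.congr_fun hadd j
          simp [Finsupp.single_eq_of_ne hj] at this
          exact this.1
        have hβs : β = Finsupp.single i (β i) := by
          ext j
          by_cases hj : j = i
          · simp [hj]
          · rw [hβ0 j hj, Finsupp.single_eq_of_ne hj]
        have h1 : β = Finsupp.single i 1 := by
          rw [hβs, Finsupp.degree_single] at hβ
          rw [hβs, hβ]
        refine hne (Prod.ext h1 ?_)
        have h2 : Finsupp.single i 1 + γ = Finsupp.single i 1 + Finsupp.single i w.length := by
          rw [← Finsupp.single_add, add_comm 1 w.length, ← h1]
          exact hadd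
        exact add_left_cancel h2
      · rw [laplace_letter_of_degree_ne e β hβ, zero_mul]
    · intro hx
      exfalso
      apply hx
      rw [Finset.HasAntidiagonal.mem_antidiagonal, ← Finsupp.single_add, List.length_cons, add_comm]

theorem rowExponent_highestWeight (lam : YoungDiagram) (i : ℕ) :
    rowExponent (SemistandardYoungTableau.highestWeight lam) i =
      Finsupp.single i (lam.rowLen i) := by
  rw [rowExponent, Finset.sum_congr rfl (g := fun _ => Finsupp.single i 1)]
  · simp
  · intro j hj
    rw [SemistandardYoungTableau.highestWeight_apply, if_pos]
    rw [YoungDiagram.mem_iff_lt_rowLen]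
    exact Finset.mem_range.mp hj

theorem rowWord_length {lam : YoungDiagram} {n : ℕ} (T : Tableau lam n) (i : ℕ) :
    (rowWord T i).length = lam.rowLen i := List.length_ofFn

/-- If the rows of `T` are independent, then `tab(T|S)` is nonzero in `W(M)` for the tableau `S`
whose `i`-th row is constant. -/
theorem mk_tab_highestWeight_ne_zero {lam : YoungDiagram} {n d : ℕ} {M : Matroid (Fin n)}
    {f : Fin n → Fin d → ℂ} (hf : ∀ I : Set (Fin n), M.Indep I ↔ LinearIndepOn ℂ f I)
    (T : Tableau lam n) (hT : ∀ i, LinearIndependent ℂ ((rowWord T i).map f).get) :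
    WhitneyModule.mk M (tab T (SemistandardYoungTableau.highestWeight lam)) ≠ 0 := by
  rw [Ne, mk_eq_zero_iff]
  intro hmem
  have h0 := whitneyIdeal_le_ker_realize hf hmem
  rw [TwoSidedIdeal.mem_ker] at h0
  revert h0
  -- `B` lists the boxes row by row, and `u` places the vector of each box in the summand of its row
  -- index; vectors in distinct summands cannot interfere.
  let B : List (Σ i, Fin ((rowWord T i).map f).length) :=
    (List.range (lam.colLen 0)).sigma fun i => List.finRange _
  let u : (Σ i, Fin ((rowWord T i).map f).length) → PlaceSpace d :=
    fun x => Finsupp.single x.1 (((rowWord T x.1).map f).get x.2)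
  have hu : LinearIndependent ℂ u :=
    Finsupp.linearIndependent_single (fun i => ((rowWord T i).map f).get) hT
  have hB : B.Nodup := List.nodup_range.sigma fun i => List.nodup_finRange _
  have hlin : LinearIndependent ℂ (B.map u).get := by
    have h1 : LinearIndependent ℂ (u ∘ B.get) := hu.comp _ (List.nodup_iff_injective_get.mp hB)
    have h2 := h1.comp (Fin.cast (List.length_map u)) (Fin.cast_injective _)
    convert h2 using 1
    ext1 k
    simp
  have h3 : realize f (tab T (SemistandardYoungTableau.highestWeight lam)) =
      ((B.map u).map (ExteriorAlgebra.ι ℂ)).prod := by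
    rw [tab, map_list_prod, List.map_map, List.map_map]
    have h4 : ∀ i, realize f (laplace (wordElt (rowWord T i))
        (rowExponent (SemistandardYoungTableau.highestWeight lam) i)) =
        (List.map (fun k => ExteriorAlgebra.ι ℂ (u ⟨i, k⟩)) (List.finRange _)).prod := by
      intro i
      rw [rowExponent_highestWeight, ← rowWord_length T i, laplace_wordElt_single, map_list_prod,
        List.map_map]
      congr 1
      have h5 : (List.map (fun k => ExteriorAlgebra.ι ℂ (u ⟨i, k⟩)) (List.finRange _)) =
          ((List.finRange _).map ((rowWord T i).map f).get).map
            fun v => ExteriorAlgebra.ι ℂ (Finsupp.single i v) := by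
        rw [List.map_map]; rfl
      rw [h5, ← List.ofFn_eq_map, List.ofFn_get, List.map_map]
      exact List.map_congr_left fun e _ => realize_letterPlace f e i
    have h6 : ∀ l : List ℕ, (l.map fun i => realize f (laplace (wordElt (rowWord T i))
        (rowExponent (SemistandardYoungTableau.highestWeight lam) i))).prod =
        ((l.sigma fun i => List.finRange ((rowWord T i).map f).length).map
          fun x => ExteriorAlgebra.ι ℂ (u x)).prod := by
      intro l
      induction l with
      | nil => simp
      | cons i l ih =>
        rw [List.map_cons, List.prod_cons, ih, List.sigma_cons, List.map_append, List.prod_append,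
          h4, List.map_map]
        rfl
    exact h6 _
  rw [h3]
  exact prod_map_ι_ne_zero _ hlin

/-! ### Tableaux and partitions into independent sets -/

/-- The elements of the parallel extension of `M` in bijection with the boxes of a tableau. -/
theorem exists_equiv_of_content {lam : YoungDiagram} {n : ℕ} {T : Tableau lam n} {μ : Fin n → ℕ}
    (hT : ∀ e, content T e = μ e) :
    ∃ g : {c // c ∈ lam} ≃ (Σ e : Fin n, Fin (μ e)), ∀ c, (g c).1 = T c := by
  have hfin : Finite {c : ℕ × ℕ // c ∈ lam} := lam.cells.finite_toSet
  have h : ∀ e, Nonempty ({c // T c = e} ≃ Fin (μ e)) := fun e =>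
    ⟨Finite.equivFinOfCardEq (hT e)⟩
  refine ⟨(Equiv.sigmaFiberEquiv T).symm.trans (Equiv.sigmaCongrRight fun e => (h e).some), ?_⟩
  intro c
  rfl

theorem card_eq_of_content {lam : YoungDiagram} {n : ℕ} {T : Tableau lam n} {μ : Fin n → ℕ}
    (hT : ∀ e, content T e = μ e) : lam.card = ∑ e, μ e := by
  obtain ⟨g, -⟩ := exists_equiv_of_content hT
  have h := Nat.card_congr g
  rw [Nat.card_sigma] at h
  simp only [Nat.card_fin] at h
  rw [← h]
  exact (Nat.card_eq_finsetCard lam.cells).symm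

theorem wordElt_eq_zero_of_not_nodup {n : ℕ} (w : List (Fin n)) (h : ¬ w.Nodup) :
    wordElt w = 0 := by
  have h1 : ¬ Function.Injective (w.map fun e => Finsupp.single e (1 : ℤ)).get := by
    rw [← List.nodup_iff_injective_get, List.nodup_map_iff]
    · exact h
    · exact Finsupp.single_left_injective one_ne_zero
  have h2 := (ExteriorAlgebra.ιMulti ℤ _ (M := Fin n →₀ ℤ)).map_eq_zero_of_not_injective _ h1
  rw [ExteriorAlgebra.ιMulti_apply] at h2
  rw [← h2, wordElt]
  congr 1
  have h3 := congrArg (List.map (ExteriorAlgebra.ι ℤ))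
    (List.ofFn_get (w.map fun e => Finsupp.single e (1 : ℤ)))
  rw [List.map_ofFn, List.map_map] at h3
  exact h3.symm

/-- The rows of `T` are independent words if `tab(T|S)` is nonzero in `W(M)`. -/
theorem row_indep_of_mk_tab_ne_zero {lam : YoungDiagram} {n : ℕ} {M : Matroid (Fin n)}
    (hE : M.E = Set.univ) {T : Tableau lam n} {S : SemistandardYoungTableau lam}
    (h : WhitneyModule.mk M (tab T S) ≠ 0) {i : ℕ} (hi : i < lam.colLen 0) :
    (rowWord T i).Nodup ∧ M.Indep {e | e ∈ rowWord T i} := by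
  have hne : WhitneyModule.mk M (laplace (wordElt (rowWord T i)) (rowExponent S i)) ≠ 0 := by
    intro h0
    apply h
    rw [tab, map_list_prod, List.map_map]
    exact List.prod_eq_zero (List.mem_map.mpr ⟨i, List.mem_range.mpr hi, h0⟩)
  constructor
  · by_contra hnd
    apply hne
    rw [wordElt_eq_zero_of_not_nodup _ hnd, laplace, map_zero, map_zero, map_zero]
  · by_contra hind
    apply hne
    rw [mk_eq_zero_iff]
    -- Not independent means dependent because every letter lies in the ground set; the degree
    -- condition holds as each box of the row contributes one to the exponent.
    refine TwoSidedIdeal.subset_span ⟨_, _, ⟨hind, by simp [hE]⟩, ?_, rfl⟩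
    rw [rowExponent, map_sum, rowWord_length]
    simp

theorem dominated_of_mk_tab_ne_zero {lam : YoungDiagram} {n : ℕ} {M : Matroid (Fin n)}
    (hE : M.E = Set.univ) {μ : Fin n → ℕ} {T : Tableau lam n} {S : SemistandardYoungTableau lam}
    (hT : ∀ e, content T e = μ e) (h : WhitneyModule.mk M (tab T S) ≠ 0) :
    Dominated lam.rowLen (rankPartition (parallelExtension M μ)) := by
  obtain ⟨g, hg⟩ := exists_equiv_of_content hT
  have hfin : Finite {c : ℕ × ℕ // c ∈ lam} := lam.cells.finite_toSet
  -- Independence in `M_μ` asks for an independent set of underlying letters and no two copies of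
  -- one letter, which are the two properties of a row word.
  have hindep : ∀ i, (parallelExtension M μ).Indep (g '' {c | c.1.1 = i}) := by
    intro i
    rw [parallelExtension, Matroid.comap_indep_iff]
    by_cases hi : i < lam.colLen 0
    · obtain ⟨hnd, hind⟩ := row_indep_of_mk_tab_ne_zero hE h hi
      constructor
      · refine hind.subset ?_
        rintro _ ⟨_, ⟨⟨⟨a, b⟩, hc⟩, rfl, rfl⟩, rfl⟩
        rw [hg, Set.mem_ofPred_eq, rowWord, List.mem_ofFn]
        exact ⟨⟨b, YoungDiagram.mem_iff_lt_rowLen.mp hc⟩, rfl⟩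
      · rintro _ ⟨⟨⟨a, b⟩, hc⟩, rfl, rfl⟩ _ ⟨⟨⟨a', b'⟩, hc'⟩, h1, rfl⟩ heq
        obtain rfl : a' = a := h1
        rw [hg, hg] at heq
        rw [rowWord, List.nodup_ofFn] at hnd
        have h2 := @hnd ⟨b, YoungDiagram.mem_iff_lt_rowLen.mp hc⟩
          ⟨b', YoungDiagram.mem_iff_lt_rowLen.mp hc'⟩ heq
        obtain rfl : b = b' := congrArg Fin.val h2
        rfl
    · have hempty : {c : {c // c ∈ lam} | c.1.1 = i} = ∅ := by
        ext ⟨⟨a, b⟩, hc⟩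
        simp only [Set.mem_ofPred_eq, Set.mem_empty_iff_false, iff_false]
        rintro rfl
        apply hi
        rw [← YoungDiagram.mem_iff_lt_colLen]
        exact lam.up_left_mem le_rfl (Nat.zero_le b) hc
      simp [hempty]
  have hle : ∀ k, ∑ i ∈ Finset.range k, lam.rowLen i ≤ maxUnion (parallelExtension M μ) k := by
    intro k
    refine le_csSup (bddAbove_maxUnion _ _) ⟨fun i => g '' {c | c.1.1 = i}, fun i => hindep i, ?_⟩
    rw [← Set.image_iUnion, Set.ncard_image_of_injective _ g.injective,
      ← Set.ncard_image_of_injective _ Subtype.val_injective]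
    have hset : (Subtype.val '' ⋃ i : Fin k, {c : {c // c ∈ lam} | c.1.1 = i}) =
        (((Finset.range k).biUnion lam.row : Finset (ℕ × ℕ)) : Set (ℕ × ℕ)) := by
      ext ⟨a, b⟩
      constructor
      · rintro ⟨⟨c, hc⟩, hk, rfl⟩
        obtain ⟨i, hi⟩ := Set.mem_iUnion.mp hk
        have hi' : a = i := hi
        simp [YoungDiagram.mem_row_iff, hi', hi' ▸ hc]
      · intro hab
        simp only [Finset.coe_biUnion, Set.mem_iUnion, Finset.mem_coe, Finset.mem_range,
          YoungDiagram.mem_row_iff] at hab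
        obtain ⟨i, hi, hc, rfl⟩ := hab
        exact ⟨⟨_, hc⟩, Set.mem_iUnion.mpr ⟨⟨_, hi⟩, rfl⟩, rfl⟩
    rw [hset, Set.ncard_coe_finset, Finset.card_biUnion]
    · exact Finset.sum_congr rfl fun i _ => lam.rowLen_eq_card.symm
    · intro i _ j _ hij
      rw [Function.onFun, Finset.disjoint_left]
      intro c hi hj
      rw [YoungDiagram.mem_row_iff] at hi hj
      exact hij (hi.2.symm.trans hj.2)
  -- From the last row on, the shape already has total `∑ e, μ e`, the size of the ground set of
  -- `M_μ`, which no union can exceed.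
  refine ⟨fun k => by rw [sum_rankPartition]; exact hle k, lam.colLen 0, fun k hk => ?_⟩
  rw [sum_rankPartition]
  refine le_antisymm (hle k) ?_
  have h1 : ∑ i ∈ Finset.range k, lam.rowLen i = ∑ e, μ e := by
    rw [← card_eq_of_content hT, card_eq_sum_rowLen]
    refine (Finset.sum_subset (Finset.range_subset_range.mpr hk) ?_).symm
    intro i _ hi
    exact rowLen_eq_zero (by simpa using hi)
  rw [h1]
  refine csSup_le ⟨_, fun _ => ∅, fun _ => (parallelExtension M μ).empty_indep, rfl⟩ ?_
  rintro m ⟨I, -, rfl⟩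
  exact (Set.ncard_le_card _).trans (by simp)

/-- A shape dominated by the rank partition of `M_μ` has a tableau with independent rows and
content `μ`. -/
theorem exists_tableau_of_dominated {n : ℕ} (M : Matroid (Fin n)) (lam : YoungDiagram)
    (μ : Fin n → ℕ) (hcard : lam.card = ∑ e, μ e)
    (hdom : Dominated lam.rowLen (rankPartition (parallelExtension M μ))) :
    ∃ T : Tableau lam n, (∀ e, content T e = μ e) ∧
      ∀ i, (rowWord T i).Nodup ∧ M.Indep {e | e ∈ rowWord T i} := by
  obtain ⟨φ, hφ⟩ := exists_indep_partition_rowLen (parallelExtension M μ) lam (by simp [hcard])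
    (fun k => by rw [← sum_rankPartition]; exact hdom.1 k)
  have hfib : ∀ i : Fin (lam.colLen 0), Nonempty (Fin (lam.rowLen i) ≃ {x // φ x = i}) := by
    intro i
    refine ⟨(Fintype.equivFinOfCardEq ?_).symm⟩
    rw [← (hφ i).2, Fintype.card_subtype]
  have hrow : ∀ c : {c // c ∈ lam}, c.1.1 < lam.colLen 0 := by
    rintro ⟨⟨a, b⟩, hc⟩
    rw [← YoungDiagram.mem_iff_lt_colLen]
    exact lam.up_left_mem le_rfl (Nat.zero_le b) hc
  let box : {c // c ∈ lam} ≃ Σ i : Fin (lam.colLen 0), Fin (lam.rowLen i) :=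
    { toFun := fun c => ⟨⟨c.1.1, hrow c⟩, ⟨c.1.2, YoungDiagram.mem_iff_lt_rowLen.mp c.2⟩⟩
      invFun := fun x => ⟨(x.1, x.2), YoungDiagram.mem_iff_lt_rowLen.mpr x.2.2⟩
      left_inv := fun _ => rfl
      right_inv := fun _ => rfl }
  -- Row `i` is filled by an arbitrary enumeration of the `i`-th class; the order of letters within
  -- a row is irrelevant to independence.
  let g : {c // c ∈ lam} ≃ Σ e : Fin n, Fin (μ e) :=
    box.trans ((Equiv.sigmaCongrRight fun i => (hfib i).some).trans (Equiv.sigmaFiberEquiv φ))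
  have hgφ : ∀ c, φ (g c) = ⟨c.1.1, hrow c⟩ := fun c =>
    ((hfib ⟨c.1.1, hrow c⟩).some ⟨c.1.2, YoungDiagram.mem_iff_lt_rowLen.mp c.2⟩).2
  refine ⟨fun c => (g c).1, fun e => ?_, fun i => ?_⟩
  · rw [content, ← Nat.card_fin (μ e)]
    refine Nat.card_congr ((g.subtypeEquiv (q := fun x => x.1 = e) fun _ => Iff.rfl).trans ?_)
    exact Equiv.sigmaSubtype e
  · by_cases hi : i < lam.colLen 0
    · have h1 := (hφ ⟨i, hi⟩).1
      rw [parallelExtension, Matroid.comap_indep_iff] at h1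
      have hmem : ∀ j : Fin (lam.rowLen i),
          g ⟨(i, j), YoungDiagram.mem_iff_lt_rowLen.mpr j.2⟩ ∈ {x | φ x = ⟨i, hi⟩} :=
        fun j => hgφ _
      constructor
      · rw [rowWord, List.nodup_ofFn]
        intro j j' hjj
        have h2 := g.injective (h1.2 (hmem j) (hmem j') hjj)
        exact Fin.ext (congrArg (fun c => c.1.2) h2)
      · refine h1.1.subset fun e he => ?_
        rw [Set.mem_ofPred_eq, rowWord, List.mem_ofFn] at he
        obtain ⟨j, rfl⟩ := he
        exact ⟨_, hmem j, rfl⟩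
    · have hnil : rowWord (fun c => (g c).1) i = [] :=
        List.eq_nil_of_length_eq_zero
          ((rowWord_length _ i).trans (rowLen_eq_zero (not_lt.mp hi)))
      simp [hnil]

theorem linearIndependent_get_of_indep {n d : ℕ} {M : Matroid (Fin n)} {f : Fin n → Fin d → ℂ}
    (hf : ∀ I : Set (Fin n), M.Indep I ↔ LinearIndepOn ℂ f I) (w : List (Fin n))
    (hnd : w.Nodup) (hw : M.Indep {e | e ∈ w}) : LinearIndependent ℂ (w.map f).get := by
  have h1 : LinearIndependent ℂ fun e : {e | e ∈ w} => f e := (hf _).mp hw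
  have h2 := h1.comp (fun k : Fin (w.map f).length =>
    (⟨w.get (k.cast (List.length_map f)), List.get_mem _ _⟩ : {e | e ∈ w})) <| by
      intro k k' hkk
      exact Fin.cast_injective _ (List.nodup_iff_injective_get.mp hnd (congrArg Subtype.val hkk))
  convert h2 using 1
  ext1 k
  simp

end WhitneyTableaux

end

theorem mainTheorem5 (n : ℕ) (M : Matroid (Fin n)) (hE : M.E = Set.univ)
    (hM : WhitneyTableaux.IsRealizable M) (lam : YoungDiagram) (μ : Fin n → ℕ) :
    (∃ (T : WhitneyTableaux.Tableau lam n) (S : SemistandardYoungTableau lam),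
        (∀ e, WhitneyTableaux.content T e = μ e) ∧
          WhitneyTableaux.WhitneyModule.mk M (WhitneyTableaux.tab T S) ≠ 0) ↔
      lam.card = ∑ e, μ e ∧
        WhitneyTableaux.Dominated lam.rowLen
          (WhitneyTableaux.rankPartition (WhitneyTableaux.parallelExtension M μ)) := by
  constructor
  · rintro ⟨T, S, hT, h⟩
    exact ⟨WhitneyTableaux.card_eq_of_content hT,
      WhitneyTableaux.dominated_of_mk_tab_ne_zero hE hT h⟩
  · rintro ⟨hcard, hdom⟩
    obtain ⟨d, f, hf⟩ := hM
    obtain ⟨T, hT, hrow⟩ := WhitneyTableaux.exists_tableau_of_dominated M lam μ hcard hdom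
    exact ⟨T, SemistandardYoungTableau.highestWeight lam, hT,
      WhitneyTableaux.mk_tab_highestWeight_ne_zero hf T fun i =>
        WhitneyTableaux.linearIndependent_get_of_indep hf _ (hrow i).1 (hrow i).2⟩
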